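/- Exponent sequences are families $r=(r_\beta)$ of real numbers indexed by all ordinals such that for some ordinal $\alpha$ we have $r_\beta=0$ for all $\beta\ge\alpha$. Let $\mathfrak L$ be the ordered abelian group of formal monomials $\ell^r=\prod_\beta \ell_\beta^{r_\beta}$, with $\ell^r\cdot\ell^s=\ell^{r+s}$ and $\ell^r\prec\ell^s$ iff $r_\beta<s_\beta$ at the least $\beta$ with $r_\beta\neq s_\beta$. Let $\mathfrak L_{<\alpha}$ be the subgroup of the $\ell^r$ with $r_\beta=0$ for all $\beta\ge\alpha$, let $\mathbb L_{<\alpha}=\mathbb R[[\mathfrak L_{<\alpha}]]$ be the ordered Hahn field of well-based series over $\mathbb R$ with monomials in $\mathfrak L_{<\alpha}$ (a nonzero series being positive iff its leading coefficient is positive), and let $\mathbb L=\bigcup_\alpha\mathbb L_{<\alpha}$, an ordered field extension of $\mathbb R$. Let $\partial$ be the $\mathbb R$-linear derivation on $\mathbb L$ that commutes with infinite sums and satisfies $$\partial(\ell^r)=\sum_\beta r_\beta\,\ell^r\prod_{\gamma\le\beta}\ell_\gamma^{-1}\quad\text{for all exponent sequences } r;$$ in particular $\partial\ell_\alpha=\prod_{\beta<\alpha}\ell_\beta^{-1}$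 for all $\alpha$. An $H$-field is an ordered field $K$ with a derivation $\partial$ such that, with $C=\{c\in K:\partial c=0\}$: (1) if $f\in K$ and $f>C$, then $\partial f>0$; (2) if $f\in K$ lies in the convex hull of $C$ in $K$, then $f=c+\varepsilon$ for some $c\in C$ and $\varepsilon\in K$ with $|\varepsilon|<d$ for all $d\in C$ with $d>0$. **Theorem.** $\{f\in\mathbb L:\partial f=0\}=\mathbb R$, $(\mathbb L,\partial)$ is an $H$-field, and $\partial\mathbb L=\mathbb L$. Consequently there is an operator $\int:\mathbb L\to\mathbb L$ that assigns to each $f\in\mathbb L$ the unique $g\in\mathbb L$ with $\partial g=f$ and $1\notin\operatorname{supp} g$. -/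

import Mathlib

universe u

noncomputable section

namespace LogHyper

/-- Exponent sequences: families `(r_β)` of reals indexed by all ordinals such that for some `α`
we have `r_β = 0` for all `β ≥ α`. They form an additive group, ordered lexicographically: `r < s`
iff `r_β < s_β` at the least `β` with `r_β ≠ s_β`. This is the ordered group of logarithmic
hypermonomials `ℓ^r = ∏_β ℓ_β ^ r_β` (with `≺` as ordering), written additively. -/
def Exponents : AddSubgroup (Lex (Ordinal.{u} → ℝ)) where
  carrier := {r | ∃ α, ∀ β, α ≤ β → r β = 0}
  zero_mem' := ⟨0, fun _ _ => rfl⟩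
  add_mem' := by
    rintro r s ⟨a, ha⟩ ⟨b, hb⟩
    refine ⟨max a b, fun β hβ => ?_⟩
    change r β + s β = 0
    rw [ha β ((le_max_left _ _).trans hβ), hb β ((le_max_right _ _).trans hβ), add_zero]
  neg_mem' := by
    rintro r ⟨a, ha⟩
    refine ⟨a, fun β hβ => ?_⟩
    change -r β = 0
    rw [ha β hβ, neg_zero]

/-- The exponent `r_β`. -/
def expo (r : Exponents.{u}) (β : Ordinal.{u}) : ℝ := r.1 β

@[simp] lemma expo_zero (β : Ordinal.{u}) : expo 0 β = 0 := rfl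
@[simp] lemma expo_add (r s : Exponents.{u}) (β : Ordinal.{u}) :
    expo (r + s) β = expo r β + expo s β := rfl
@[simp] lemma expo_neg (r : Exponents.{u}) (β : Ordinal.{u}) : expo (-r) β = -expo r β := rfl

/-- The group `𝔏_{<α}` of hypermonomials `ℓ^r` with `r_β = 0` for all `β ≥ α`. -/
def exponentsBelow (α : Ordinal.{u}) : AddSubgroup Exponents.{u} where
  carrier := {r | ∀ β, α ≤ β → expo r β = 0}
  zero_mem' := fun _ _ => rfl
  add_mem' := fun {r s} hr hs β hβ => by simp [hr β hβ, hs β hβ]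
  neg_mem' := fun {r} hr β hβ => by simp [hr β hβ]

lemma exponentsBelow_mono {α β : Ordinal.{u}} (h : α ≤ β) :
    exponentsBelow α ≤ exponentsBelow β :=
  fun _ hr γ hγ => hr γ (h.trans hγ)

lemma exists_mem_exponentsBelow (r : Exponents.{u}) : ∃ α, r ∈ exponentsBelow α := r.2

/-- The exponent sequence of the hyperlogarithm `ℓ_α`. -/
def ellExp (α : Ordinal.{u}) : Exponents.{u} :=
  ⟨toLex fun β => if β = α then 1 else 0, Order.succ α, fun _β hβ =>
    if_neg ((Order.lt_succ α).trans_le hβ).ne'⟩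

/-- The exponent sequence of `∏_{β<α} ℓ_β⁻¹`. -/
def ellDerivExp (α : Ordinal.{u}) : Exponents.{u} :=
  ⟨toLex fun β => if β < α then -1 else 0, α, fun _β hβ => if_neg hβ.not_gt⟩

/-- The exponent sequence of `ℓ_β^† = ∏_{γ≤β} ℓ_γ⁻¹`. -/
def ellDaggerExp (β : Ordinal.{u}) : Exponents.{u} := ellDerivExp (Order.succ β)

lemma ellDerivExp_mem (α : Ordinal.{u}) : ellDerivExp α ∈ exponentsBelow α :=
  fun _ hβ => if_neg hβ.not_gt

lemma ellExp_mem (α : Ordinal.{u}) : ellExp α ∈ exponentsBelow (Order.succ α) :=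
  fun _ hβ => if_neg ((Order.lt_succ α).trans_le hβ).ne'

lemma ellExp_add_ellDaggerExp (α : Ordinal.{u}) :
    ellExp α + ellDaggerExp α = ellDerivExp α := by
  apply Subtype.ext
  funext β
  change (if β = α then (1 : ℝ) else 0) + (if β < Order.succ α then -1 else 0)
    = if β < α then -1 else 0
  rcases lt_trichotomy β α with h | rfl | h
  · simp [h.ne, h, h.le]
  · simp
  · simp [h.ne', h.not_gt, h.not_ge]

lemma ellDaggerExp_antitone : Antitone ellDaggerExp.{u} := by
  intro α β h
  rcases h.eq_or_lt with rfl | h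
  · exact le_rfl
  have hlt : (ellDaggerExp β).1 < (ellDaggerExp α).1 := by
    refine ⟨Order.succ α, fun γ hγ => ?_, ?_⟩
    · have h1 : γ ≤ α := Order.lt_succ_iff.1 hγ
      change (if γ < Order.succ β then (-1 : ℝ) else 0) = if γ < Order.succ α then -1 else 0
      rw [if_pos (Order.lt_succ_iff.2 (h1.trans h.le)), if_pos hγ]
    · change (if Order.succ α < Order.succ β then (-1 : ℝ) else 0)
        < if Order.succ α < Order.succ α then -1 else 0
      rw [if_pos (Order.succ_lt_succ h), if_neg (lt_irrefl _)]
      norm_num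
  exact hlt.le

/-- Hahn series with real coefficients and monomials in the class of all hypermonomials. The index
group carries the opposite order since supports are to be well-ordered for the reverse of `≺`. The
coefficient of `ℓ^r` is `f.coeff (OrderDual.toDual r)`. -/
abbrev Series : Type (u + 1) := HahnSeries (Exponents.{u})ᵒᵈ ℝ

/-- `f` is a series with monomials in `𝔏_{<α}`, i.e. an element of the Hahn field `𝕃_{<α}`. -/
def IsBelow (α : Ordinal.{u}) (f : Series.{u}) : Prop :=
  ∀ r ∈ f.support, OrderDual.ofDual r ∈ exponentsBelow α

lemma IsBelow.mono {α β : Ordinal.{u}} (h : α ≤ β) {f : Series.{u}} (hf : IsBelow α f) :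
    IsBelow β f := fun r hr => exponentsBelow_mono h (hf r hr)

lemma IsBelow.add {α : Ordinal.{u}} {f g : Series.{u}} (hf : IsBelow α f) (hg : IsBelow α g) :
    IsBelow α (f + g) := fun r hr =>
  (HahnSeries.support_add_subset f g hr).elim (hf r) (hg r)

lemma IsBelow.mul {α : Ordinal.{u}} {f g : Series.{u}} (hf : IsBelow α f) (hg : IsBelow α g) :
    IsBelow α (f * g) := by
  intro r hr
  obtain ⟨a, ha, b, hb, rfl⟩ := Set.mem_add.1 (HahnSeries.support_mul_subset hr)
  exact (exponentsBelow α).add_mem (hf a ha) (hg b hb)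

lemma isBelow_single {α : Ordinal.{u}} {r : Exponents.{u}} (hr : r ∈ exponentsBelow α) (c : ℝ) :
    IsBelow α (HahnSeries.single (OrderDual.toDual r) c) := by
  intro s hs
  rw [Set.mem_singleton_iff.1 (HahnSeries.support_single_subset hs)]
  exact hr

lemma isBelow_algebraMap (α : Ordinal.{u}) (c : ℝ) : IsBelow α (algebraMap ℝ Series.{u} c) :=
  isBelow_single (α := α) (r := 0) (exponentsBelow α).zero_mem c

/-- The inclusion of monomial groups `𝔏_{<α} → 𝔏`. -/
def belowHom (α : Ordinal.{u}) : (exponentsBelow α)ᵒᵈ →+ (Exponents.{u})ᵒᵈ where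
  toFun r := OrderDual.toDual (OrderDual.ofDual r).1
  map_zero' := rfl
  map_add' _ _ := rfl

lemma belowHom_injective (α : Ordinal.{u}) : Function.Injective (belowHom α) :=
  fun _ _ h => Subtype.ext h

lemma IsBelow.inv {α : Ordinal.{u}} {f : Series.{u}} (hf : IsBelow α f) : IsBelow α f⁻¹ := by
  let φ : HahnSeries (exponentsBelow α)ᵒᵈ ℝ →+* Series.{u} :=
    HahnSeries.embDomainRingHom (belowHom α) (belowHom_injective α) fun _ _ => Iff.rfl
  let e : (exponentsBelow α)ᵒᵈ ↪o (Exponents.{u})ᵒᵈ :=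
    ⟨⟨belowHom α, belowHom_injective α⟩, Iff.rfl⟩
  have hφ : ∀ g, φ g = HahnSeries.embDomain e g := fun _ => rfl
  have hrange : ∀ g, IsBelow α (φ g) := by
    intro g r hr
    rw [hφ] at hr
    obtain ⟨s, -, rfl⟩ := HahnSeries.support_embDomain_subset hr
    exact (OrderDual.ofDual s).2
  have hpwo : Set.IsPWO {r : (exponentsBelow α)ᵒᵈ | f.coeff (belowHom α r) ≠ 0} := by
    rw [Set.isPWO_iff_isWF]
    have := f.isWF_support
    refine Set.isWF_iff_no_descending_seq.2 fun s hs hmem => ?_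
    exact Set.isWF_iff_no_descending_seq.1 this (fun n => e (s n))
      (fun m n hmn => e.lt_iff_lt.2 (hs hmn)) fun n => hmem n
  let g : HahnSeries (exponentsBelow α)ᵒᵈ ℝ := ⟨fun r => f.coeff (belowHom α r), hpwo⟩
  have hg : φ g = f := by
    rw [hφ]
    ext r
    by_cases hr : OrderDual.ofDual r ∈ exponentsBelow α
    · exact HahnSeries.embDomain_coeff (f := e) (x := g) (a := OrderDual.toDual ⟨_, hr⟩)
    · rw [HahnSeries.embDomain_of_notMem_range]
      · by_contra h
        exact hr (hf r (Ne.symm h))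
      · rintro ⟨s, rfl⟩
        exact hr (OrderDual.ofDual s).2
  rw [← hg, ← map_inv₀]
  exact hrange _

/-- The field `𝕃 = ⋃_α ℝ[[𝔏_{<α}]]` of logarithmic hyperseries. -/
def LL : IntermediateField ℝ Series.{u} where
  carrier := {f | ∃ α, IsBelow α f}
  add_mem' := by
    rintro f g ⟨a, ha⟩ ⟨b, hb⟩
    exact ⟨max a b, (ha.mono (le_max_left _ _)).add (hb.mono (le_max_right _ _))⟩
  mul_mem' := by
    rintro f g ⟨a, ha⟩ ⟨b, hb⟩
    exact ⟨max a b, (ha.mono (le_max_left _ _)).mul (hb.mono (le_max_right _ _))⟩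
  algebraMap_mem' c := ⟨0, isBelow_algebraMap 0 c⟩
  inv_mem' := by
    rintro f ⟨a, ha⟩
    exact ⟨a, ha.inv⟩

/-- The ordering of `𝕃`: `f < g` iff `f_𝔪 < g_𝔪` for the `≺`-largest `𝔪` with `f_𝔪 ≠ g_𝔪`;
equivalently, `f > 0` iff `f ≠ 0` and the leading coefficient of `f` is positive. -/
instance : LinearOrder LL.{u} :=
  LinearOrder.lift' (fun f : LL.{u} => toLex f.1) fun _ _ h => Subtype.ext h

instance : IsStrictOrderedRing LL.{u} :=
  Function.Injective.isStrictOrderedRing (fun f : LL.{u} => toLex f.1) rfl rfl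
    (fun _ _ => rfl) (fun _ _ => rfl) Iff.rfl Iff.rfl

/-- The hypermonomial `ℓ^r` as an element of `𝕃`. -/
def mono (r : Exponents.{u}) : LL.{u} :=
  ⟨HahnSeries.single (OrderDual.toDual r) 1, by
    obtain ⟨α, hα⟩ := exists_mem_exponentsBelow r
    exact ⟨α, isBelow_single hα 1⟩⟩

/-- The support of `f ∈ 𝕃`, a class of hypermonomials. -/
def supp (f : LL.{u}) : Set Exponents.{u} := {r | f.1.coeff (OrderDual.toDual r) ≠ 0}

/-- `∑_r f_r ℓ^r ↦ ∑_r r_β f_r ℓ^r`. -/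
def weight (β : Ordinal.{u}) : Series.{u} →ₗ[ℝ] Series.{u} where
  toFun f := ⟨fun r => expo (OrderDual.ofDual r) β * f.coeff r,
    f.isPWO_support.mono fun _ hr => right_ne_zero_of_mul hr⟩
  map_add' f g := by ext r; simp [mul_add]
  map_smul' c f := by ext r; simp; ring

@[simp] lemma weight_coeff (β : Ordinal.{u}) (f : Series.{u}) (r : (Exponents.{u})ᵒᵈ) :
    (weight β f).coeff r = expo (OrderDual.ofDual r) β * f.coeff r := rfl

lemma support_weight_subset (β : Ordinal.{u}) (f : Series.{u}) :
    (weight β f).support ⊆ f.support := fun _ hr => right_ne_zero_of_mul hr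

lemma weight_mul (β : Ordinal.{u}) (f g : Series.{u}) :
    weight β (f * g) = f * weight β g + g * weight β f := by
  ext r
  rw [mul_comm g, HahnSeries.coeff_add, weight_coeff, HahnSeries.coeff_mul,
    HahnSeries.coeff_mul_left' f.isPWO_support (support_weight_subset β f)]
  rw [HahnSeries.coeff_mul_right' g.isPWO_support (support_weight_subset β g), Finset.mul_sum,
    ← Finset.sum_add_distrib]
  refine Finset.sum_congr rfl fun p hp => ?_
  obtain ⟨-, -, rfl⟩ := Finset.mem_antidiagonal.1 hp
  simp only [weight_coeff, ofDual_add, expo_add]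
  ring

/-- `ℓ_β^† = ∏_{γ≤β} ℓ_γ⁻¹` as a series. -/
def dagger (β : Ordinal.{u}) : Series.{u} :=
  HahnSeries.single (OrderDual.toDual (ellDaggerExp β)) 1

lemma coeff_dagger_mul (β : Ordinal.{u}) (f : Series.{u}) (r : (Exponents.{u})ᵒᵈ) :
    (dagger β * f).coeff r = f.coeff (r - OrderDual.toDual (ellDaggerExp β)) := by
  have := HahnSeries.coeff_single_mul_add (r := (1 : ℝ)) (x := f)
    (a := r - OrderDual.toDual (ellDaggerExp β)) (b := OrderDual.toDual (ellDaggerExp β))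
  rw [sub_add_cancel, one_mul] at this
  exact this

lemma isPWO_range_dagger :
    (Set.range fun β : Ordinal.{u} => OrderDual.toDual (ellDaggerExp β)).IsPWO := by
  have hm : Monotone fun β : Ordinal.{u} => OrderDual.toDual (ellDaggerExp β) :=
    fun _ _ h => ellDaggerExp_antitone h
  rw [← Set.image_univ]
  exact Set.IsPWO.image_of_monotone (Set.isPWO_of_wellQuasiOrderedLE _) hm

lemma ellDaggerExp_injective : Function.Injective ellDaggerExp.{u} := by
  intro α β h
  by_contra hne
  wlog hlt : α < β generalizing α β
  · exact this h.symm (Ne.symm hne) (lt_of_le_of_ne (not_lt.1 hlt) (Ne.symm hne))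
  have : expo (ellDaggerExp α) β = expo (ellDaggerExp β) β := by rw [h]
  simp [expo, ellDaggerExp, ellDerivExp, hlt.not_ge] at this

/-- For `f = ∑_r f_r ℓ^r` the summable family, indexed by the ordinals `β`, of the series
`ℓ_β^† ∑_r r_β f_r ℓ^r`. -/
def derFamily (f : Series.{u}) :
    HahnSeries.SummableFamily (Exponents.{u})ᵒᵈ ℝ Ordinal.{u} where
  toFun β := dagger β * weight β f
  isPWO_iUnion_support' := by
    refine (isPWO_range_dagger.add f.isPWO_support).mono ?_
    refine Set.iUnion_subset fun β r hr => ?_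
    rw [HahnSeries.mem_support, coeff_dagger_mul] at hr
    exact Set.mem_add.2 ⟨_, ⟨β, rfl⟩, _, support_weight_subset β f hr, add_sub_cancel _ _⟩
  finite_co_support' r := by
    have hfin := Set.AddAntidiagonal.finite_of_isPWO isPWO_range_dagger f.isPWO_support r
    refine Set.Finite.of_finite_image (f := fun β =>
      (OrderDual.toDual (ellDaggerExp β), r - OrderDual.toDual (ellDaggerExp β)))
      (hfin.subset ?_) ?_
    · rintro _ ⟨β, hβ, rfl⟩
      rw [Set.mem_ofPred_eq, coeff_dagger_mul] at hβ
      exact ⟨⟨β, rfl⟩, support_weight_subset β f hβ, add_sub_cancel _ _⟩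
    · intro α _ β _ h
      exact ellDaggerExp_injective (congrArg Prod.fst h)

/-- `∑_r f_r ℓ^r ↦ ∑_β ℓ_β^† ∑_r r_β f_r ℓ^r`. -/
def derSeries : Series.{u} →ₗ[ℝ] Series.{u} where
  toFun f := (derFamily f).hsum
  map_add' f g := by
    rw [← HahnSeries.SummableFamily.hsum_add]
    congr 1
    ext1 β
    simp [derFamily, mul_add]
  map_smul' c f := by
    ext r
    simp only [RingHom.id_apply, HahnSeries.coeff_smul, HahnSeries.SummableFamily.coeff_hsum,
      smul_eq_mul]
    rw [← smul_eq_mul, smul_finsum]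
    refine finsum_congr fun β => ?_
    change (dagger β * weight β (c • f)).coeff r = c * (dagger β * weight β f).coeff r
    simp only [coeff_dagger_mul, weight_coeff, HahnSeries.coeff_smul, smul_eq_mul]
    ring

lemma derSeries_mul (f g : Series.{u}) :
    derSeries (f * g) = f * derSeries g + g * derSeries f := by
  change (derFamily (f * g)).hsum = f * (derFamily g).hsum + g * (derFamily f).hsum
  rw [← HahnSeries.SummableFamily.hsum_smul, ← HahnSeries.SummableFamily.hsum_smul,
    ← HahnSeries.SummableFamily.hsum_add]
  congr 1
  ext1 β
  change dagger β * weight β (f * g)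
    = f * (dagger β * weight β g) + g * (dagger β * weight β f)
  rw [weight_mul]
  ring

lemma IsBelow.derSeries {α : Ordinal.{u}} {f : Series.{u}} (hf : IsBelow α f) :
    IsBelow α (derSeries f) := by
  intro r hr
  obtain ⟨β, hβ⟩ := Set.mem_iUnion.1 (HahnSeries.SummableFamily.support_hsum_subset hr)
  change (dagger β * weight β f).coeff r ≠ 0 at hβ
  rw [coeff_dagger_mul] at hβ
  have h1 := hf _ (support_weight_subset β f hβ)
  have h2 : β < α := by
    by_contra h
    exact left_ne_zero_of_mul hβ (h1 β (not_lt.1 h))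
  have h3 := exponentsBelow_mono (Order.succ_le_of_lt h2) (ellDerivExp_mem (Order.succ β))
  have h4 := (exponentsBelow α).add_mem h3 h1
  have h5 : ellDerivExp (Order.succ β)
      + OrderDual.ofDual (r - OrderDual.toDual (ellDaggerExp β)) = OrderDual.ofDual r :=
    add_sub_cancel (ellDaggerExp β) (OrderDual.ofDual r)
  rwa [h5] at h4

/-- The derivation `∂` on `𝕃`: `∂ (∑_r f_r ℓ^r) = ∑_r f_r ∑_β r_β ℓ^r ∏_{γ≤β} ℓ_γ⁻¹`. -/
def der : Derivation ℝ LL.{u} LL.{u} :=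
  Derivation.mk'
    { toFun := fun f => ⟨derSeries f.1, by
        obtain ⟨α, hα⟩ := f.2
        exact ⟨α, hα.derSeries⟩⟩
      map_add' := fun f g => Subtype.ext (derSeries.map_add f.1 g.1)
      map_smul' := fun c f => Subtype.ext (derSeries.map_smul c f.1) }
    fun f g => Subtype.ext (derSeries_mul f.1 g.1)

/-- The coefficient of `ℓ^r` in `∂ f`. -/
lemma der_coeff (f : LL.{u}) (r : (Exponents.{u})ᵒᵈ) :
    (der f).1.coeff r = ∑ᶠ β, (dagger β * weight β f.1).coeff r :=
  HahnSeries.SummableFamily.coeff_hsum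

/-- `∂ ℓ^r` is the sum over all `β` of `r_β ℓ^r ∏_{γ≤β} ℓ_γ⁻¹`. -/
lemma derFamily_mono (r : Exponents.{u}) (β : Ordinal.{u}) :
    derFamily (mono r).1 β
      = HahnSeries.single (OrderDual.toDual (ellDaggerExp β + r)) (expo r β) := by
  have hw : weight β (mono r).1 = HahnSeries.single (OrderDual.toDual r) (expo r β) := by
    ext s
    rw [weight_coeff]
    by_cases hs : s = OrderDual.toDual r
    · rw [hs, HahnSeries.coeff_single_same]
      change _ * (HahnSeries.single (OrderDual.toDual r) (1 : ℝ)).coeff _ = _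
      rw [HahnSeries.coeff_single_same, mul_one]
      rfl
    · simp [mono, HahnSeries.coeff_single_of_ne hs]
  change dagger β * weight β (mono r).1 = _
  rw [hw, dagger, HahnSeries.single_mul_single, one_mul, toDual_add]

/-- `∂ ℓ_α = ∏_{β<α} ℓ_β⁻¹`. -/
lemma der_ell (α : Ordinal.{u}) : der (mono (ellExp α)) = mono (ellDerivExp α) := by
  apply Subtype.ext
  ext r
  have hw : ∀ β, weight β (mono (ellExp α)).1 = if β = α then (mono (ellExp α)).1 else 0 := by
    intro β
    ext s
    rw [weight_coeff]
    by_cases hs : s = OrderDual.toDual (ellExp α)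
    · subst hs
      by_cases h : β = α <;> simp [h, mono, expo, ellExp]
    · by_cases h : β = α <;> simp [h, mono, HahnSeries.coeff_single_of_ne hs]
  rw [der_coeff, finsum_eq_single _ α]
  · rw [hw, if_pos rfl]
    change (HahnSeries.single _ _ * HahnSeries.single _ _ : Series.{u}).coeff r = _
    rw [HahnSeries.single_mul_single, one_mul, add_comm, ← toDual_add, ellExp_add_ellDaggerExp]
    rfl
  · intro β hβ
    rw [hw, if_neg hβ, mul_zero, HahnSeries.coeff_zero]

lemma finite_dagger_mul_weight {I : Type*} (s : HahnSeries.SummableFamily (Exponents.{u})ᵒᵈ ℝ I)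
    (r : (Exponents.{u})ᵒᵈ) :
    {p : I × Ordinal.{u} | (dagger p.2 * weight p.2 (s p.1)).coeff r ≠ 0}.Finite := by
  have hfin := Set.AddAntidiagonal.finite_of_isPWO isPWO_range_dagger s.isPWO_iUnion_support r
  have hfin2 := hfin.biUnion (t := fun q => {i | (s i).coeff q.2 ≠ 0} ×ˢ {q.1})
    fun q _ => (s.finite_co_support q.2).prod (Set.finite_singleton _)
  refine Set.Finite.of_finite_image (f := fun p : I × Ordinal.{u} =>
    (p.1, OrderDual.toDual (ellDaggerExp p.2))) (hfin2.subset ?_) ?_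
  · rintro _ ⟨⟨i, β⟩, h, rfl⟩
    rw [Set.mem_ofPred_eq, coeff_dagger_mul] at h
    have h' := support_weight_subset β (s i) h
    exact Set.mem_biUnion (x := (OrderDual.toDual (ellDaggerExp β),
      r - OrderDual.toDual (ellDaggerExp β)))
      ⟨⟨β, rfl⟩, Set.mem_iUnion.2 ⟨i, h'⟩, add_sub_cancel _ _⟩ ⟨h', rfl⟩
  · rintro ⟨i, α⟩ _ ⟨j, β⟩ _ h
    replace h : (i, OrderDual.toDual (ellDaggerExp α)) = (j, OrderDual.toDual (ellDaggerExp β)) := h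
    rw [Prod.mk.injEq] at h
    exact Prod.ext h.1 (ellDaggerExp_injective h.2)

section

open scoped Pointwise

/-- `∂` maps summable families to summable families and commutes with infinite sums. -/
lemma derSeries_hsum {I : Type*} (s : HahnSeries.SummableFamily (Exponents.{u})ᵒᵈ ℝ I) :
    ∃ t : HahnSeries.SummableFamily (Exponents.{u})ᵒᵈ ℝ I,
      (∀ i, t i = derSeries (s i)) ∧ derSeries s.hsum = t.hsum := by
  have hsupp : ∀ f : Series.{u}, (derSeries f).support ⊆
      (Set.range fun β : Ordinal.{u} => OrderDual.toDual (ellDaggerExp β)) + f.support := by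
    intro f r hr
    obtain ⟨β, hβ⟩ := Set.mem_iUnion.1 (HahnSeries.SummableFamily.support_hsum_subset hr)
    change (dagger β * weight β f).coeff r ≠ 0 at hβ
    rw [coeff_dagger_mul] at hβ
    exact Set.mem_add.2 ⟨_, ⟨β, rfl⟩, _, support_weight_subset β f hβ, add_sub_cancel _ _⟩
  have hcoeff : ∀ (f : Series.{u}) r,
      (derSeries f).coeff r = ∑ᶠ β, (dagger β * weight β f).coeff r :=
    fun f r => HahnSeries.SummableFamily.coeff_hsum (s := derFamily f)
  refine ⟨⟨fun i => derSeries (s i), ?_, ?_⟩, fun _ => rfl, ?_⟩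
  · refine (isPWO_range_dagger.add s.isPWO_iUnion_support).mono (Set.iUnion_subset fun i => ?_)
    exact (hsupp (s i)).trans (Set.add_subset_add_left (Set.subset_iUnion_of_subset i subset_rfl))
  · intro r
    refine ((finite_dagger_mul_weight s r).image Prod.fst).subset fun i hi => ?_
    rw [Set.mem_ofPred_eq, hcoeff] at hi
    obtain ⟨β, hβ⟩ : ∃ β, (dagger β * weight β (s i)).coeff r ≠ 0 := by
      by_contra! h
      exact hi ((finsum_congr h).trans finsum_zero)
    exact ⟨(i, β), hβ, rfl⟩
  · ext r
    rw [hcoeff, HahnSeries.SummableFamily.coeff_hsum]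
    change _ = ∑ᶠ i, (derSeries (s i)).coeff r
    have hfin := finite_dagger_mul_weight s r
    have h1 : ∀ β, (dagger β * weight β s.hsum).coeff r
        = ∑ᶠ i, (dagger β * weight β (s i)).coeff r := by
      intro β
      simp only [coeff_dagger_mul, weight_coeff, HahnSeries.SummableFamily.coeff_hsum]
      rw [← smul_eq_mul, smul_finsum]
      rfl
    simp only [h1, hcoeff]
    rw [← finsum_curry (fun p : I × Ordinal.{u} => (dagger p.2 * weight p.2 (s p.1)).coeff r) hfin]
    have hfin' : Function.HasFiniteSupport fun p : Ordinal.{u} × I =>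
        (dagger p.1 * weight p.1 (s p.2)).coeff r :=
      (hfin.image Prod.swap).subset fun p hp => ⟨p.swap, hp, rfl⟩
    rw [← finsum_curry (fun p : Ordinal.{u} × I =>
      (dagger p.1 * weight p.1 (s p.2)).coeff r) hfin']
    exact (finsum_comp_equiv (Equiv.prodComm I Ordinal.{u})
      (f := fun p : Ordinal.{u} × I => (dagger p.1 * weight p.1 (s p.2)).coeff r)).symm

end

/-- An ordered field `K` with derivation `∂` and constant field `C = {c : ∂ c = 0}` is an
`H`-field if (1) `∂ f > 0` for all `f > C`, and (2) every `f` in the convex hull of `C` in `K` is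
of the form `c + ε` with `c ∈ C` and `|ε|` smaller than all positive constants. -/
structure IsHField {R K : Type*} [CommRing R] [Field K] [LinearOrder K] [IsStrictOrderedRing K]
    [Algebra R K] (D : Derivation R K K) : Prop where
  der_pos : ∀ f : K, (∀ c, D c = 0 → c < f) → 0 < D f
  exists_const_add : ∀ f : K, (∃ a b, D a = 0 ∧ D b = 0 ∧ a ≤ f ∧ f ≤ b) →
    ∃ c ε, D c = 0 ∧ (∀ d, D d = 0 → 0 < d → |ε| < d) ∧ f = c + ε

end LogHyper

end

/-!
For `r ≠ 0` let `β` be the least index with `r_β ≠ 0`. The dominant monomial of `∂ ℓ^r` is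
`ℓ^r ∏_{γ≤β} ℓ_γ⁻¹`, with coefficient `r_β`. This assignment of monomials is a strictly increasing
bijection from `𝔏 ∖ {1}` onto `𝔏`, so `∂` is "triangular" with respect to it: the kernel consists of
the series supported on `1`, the sign of `∂ f` can be read off the leading term of `f`, and
`∂ g = f` can be solved term by term, the successive approximations having a limit because Hahn
fields are spherically complete.
-/

noncomputable section

namespace LogHyper

open OrderDual

section Triangular

variable {Γ Γ' A B : Type*} [LinearOrder Γ] [LinearOrder Γ']

lemma exists_hahnSeries_coeff_eq_of_coherent [Zero A] (I : Set Γ) (g : Γ → HahnSeries Γ A)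
    (hg : ∀ γ ∈ I, ∀ s ∈ I, s ≤ γ → (g γ).coeff s = (g s).coeff s) :
    ∃ f : HahnSeries Γ A, f.support ⊆ I ∧
      ∀ γ ∈ I, ∀ s ∈ I, s ≤ γ → f.coeff s = (g γ).coeff s := by
  classical
  let c : Γ → A := fun s => if s ∈ I then (g s).coeff s else 0
  have c_of_mem {s : Γ} (hs : s ∈ I) : c s = (g s).coeff s := if_pos hs
  have support_c : c.support ⊆ I := fun s hs => by
    by_contra h
    exact hs (if_neg h)
  have isPWO_support : c.support.IsPWO := by
    rw [Set.isPWO_iff_isWF, Set.isWF_iff_no_descending_seq]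
    intro s hs hmem
    have hI (n : ℕ) : s n ∈ I := support_c (hmem n)
    refine Set.isWF_iff_no_descending_seq.1 (g (s 0)).isWF_support s hs fun n => ?_
    rw [HahnSeries.mem_support, hg _ (hI 0) _ (hI n) (hs.antitone n.zero_le), ← c_of_mem (hI n)]
    exact hmem n
  exact ⟨⟨c, isPWO_support⟩, support_c,
    fun γ hγ s hs hle => (c_of_mem hs).trans (hg γ hγ s hs hle).symm⟩

/-- The map `D` of Hahn series is triangular with respect to the exponents in `S`: if `γ ∈ S` and
`a` is the coefficient of `f` at `γ`, and if `f` has no earlier term with exponent in `S`, then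
`D f` starts at `σ γ`, with coefficient `e γ a`. The exponents outside `S` do not matter for `D`. -/
structure IsTriangularOn [Zero A] [Zero B] (D : HahnSeries Γ A → HahnSeries Γ' B) (S : Set Γ)
    (σ : Γ → Γ') (e : Γ → A → B) : Prop where
  monotoneOn : MonotoneOn σ S
  injective : ∀ γ ∈ S, Function.Injective (e γ)
  coeff_map_of_lt : ∀ f, ∀ γ ∈ S, (∀ s ∈ S, s < γ → f.coeff s = 0) →
    ∀ t < σ γ, (D f).coeff t = 0
  coeff_map : ∀ f, ∀ γ ∈ S, (∀ s ∈ S, s < γ → f.coeff s = 0) →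
    (D f).coeff (σ γ) = e γ (f.coeff γ)

namespace IsTriangularOn

variable {F : Type*} [AddGroup A] [AddGroup B] [FunLike F (HahnSeries Γ A) (HahnSeries Γ' B)]
  [AddMonoidHomClass F (HahnSeries Γ A) (HahnSeries Γ' B)] {D : F} {S : Set Γ} {σ : Γ → Γ'}
  {e : Γ → A → B} {γ : Γ}

lemma leading_zero (hD : IsTriangularOn D S σ e) (hγ : γ ∈ S) : e γ 0 = 0 := by
  simpa using (hD.coeff_map 0 γ hγ fun _ _ _ => rfl).symm

lemma coeff_map_of_le (hD : IsTriangularOn D S σ e) (hγ : γ ∈ S) {f : HahnSeries Γ A}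
    (hf : ∀ s ∈ S, s ≤ γ → f.coeff s = 0) {t : Γ'} (ht : t ≤ σ γ) : (D f).coeff t = 0 := by
  have hf' : ∀ s ∈ S, s < γ → f.coeff s = 0 := fun s hs hlt => hf s hs hlt.le
  rcases ht.lt_or_eq with hlt | rfl
  · exact hD.coeff_map_of_lt f γ hγ hf' t hlt
  · rw [hD.coeff_map f γ hγ hf', hf γ hγ le_rfl, hD.leading_zero hγ]

lemma coeff_eq_zero_of_coeff_map (hD : IsTriangularOn D S σ e) (hγ : γ ∈ S) {f : HahnSeries Γ A}
    (hf : ∀ t ≤ σ γ, (D f).coeff t = 0) {s : Γ} (hs : s ∈ S) (hle : s ≤ γ) : f.coeff s = 0 := by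
  by_contra hne
  have hwf : (f.support ∩ S).IsWF := f.isWF_support.mono Set.inter_subset_left
  have hnonempty : (f.support ∩ S).Nonempty := ⟨s, hne, hs⟩
  set m := hwf.min hnonempty
  obtain ⟨hm, hmS⟩ : m ∈ f.support ∩ S := hwf.min_mem hnonempty
  have hmγ : m ≤ γ := (hwf.min_le hnonempty ⟨hne, hs⟩).trans hle
  have hmin : ∀ q ∈ S, q < m → f.coeff q = 0 := fun q hq hlt =>
    not_not.1 fun h => hwf.not_lt_min hnonempty ⟨h, hq⟩ hlt
  have hzero : e m (f.coeff m) = e m 0 := by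
    rw [← hD.coeff_map f m hmS hmin, hf _ (hD.monotoneOn hmS hγ hmγ), hD.leading_zero hmS]
  exact hm (hD.injective m hmS hzero)

lemma coeff_eq_of_map_eq (hD : IsTriangularOn D S σ e) {f g : HahnSeries Γ A} (h : D f = D g)
    (hγ : γ ∈ S) : f.coeff γ = g.coeff γ := by
  have hsub : D (f - g) = 0 := by rw [map_sub, h, sub_self]
  have := hD.coeff_eq_zero_of_coeff_map hγ (f := f - g) (fun t _ => by rw [hsub]; rfl) hγ le_rfl
  rwa [HahnSeries.coeff_sub, sub_eq_zero] at this

/-- Spherical completeness glues the approximate solutions into one that is exact up to every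
`γ` for which an approximate solution exists. -/
lemma exists_coeff_map_eq_of_le (hD : IsTriangularOn D S σ e) (f : HahnSeries Γ' B) :
    ∃ g : HahnSeries Γ A, g.support ⊆ S ∧ ∀ γ ∈ S,
      (∃ h, ∀ t ≤ σ γ, (D h).coeff t = f.coeff t) → ∀ t ≤ σ γ, (D g).coeff t = f.coeff t := by
  let I : Set Γ := {γ | γ ∈ S ∧ ∃ h, ∀ t ≤ σ γ, (D h).coeff t = f.coeff t}
  choose! h hh using fun γ (hγ : γ ∈ I) => hγ.2
  have coherent : ∀ γ ∈ I, ∀ s ∈ I, s ≤ γ → (h γ).coeff s = (h s).coeff s := by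
    intro γ hγ s hs hle
    rw [← sub_eq_zero, ← HahnSeries.coeff_sub]
    refine hD.coeff_eq_zero_of_coeff_map hs.1 (fun t ht => ?_) hs.1 le_rfl
    rw [map_sub, HahnSeries.coeff_sub, hh γ hγ t (ht.trans (hD.monotoneOn hs.1 hγ.1 hle)),
      hh s hs t ht, sub_self]
  obtain ⟨g, hgI, hg⟩ := exists_hahnSeries_coeff_eq_of_coherent I h coherent
  refine ⟨g, fun s hs => (hgI hs).1, fun γ hγS hγ t ht => ?_⟩
  have hγI : γ ∈ I := ⟨hγS, hγ⟩
  rw [← hh γ hγI t ht, ← sub_eq_zero, ← HahnSeries.coeff_sub, ← map_sub]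
  refine hD.coeff_map_of_le hγS (fun s hs hle => ?_) ht
  have hsI : s ∈ I := ⟨hs, h γ, fun t ht => hh γ hγI t (ht.trans (hD.monotoneOn hs hγS hle))⟩
  rw [HahnSeries.coeff_sub, hg γ hγI s hsI hle, sub_self]

theorem exists_map_eq (hD : IsTriangularOn D S σ e) (hσ : Set.SurjOn σ S Set.univ)
    (he : ∀ γ ∈ S, Function.Surjective (e γ)) (f : HahnSeries Γ' B) :
    ∃ g : HahnSeries Γ A, g.support ⊆ S ∧ D g = f := by
  obtain ⟨g, hgS, hg⟩ := hD.exists_coeff_map_eq_of_le f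
  refine ⟨g, hgS, ?_⟩
  by_contra hne
  have hrem : f - D g ≠ 0 := sub_ne_zero.2 (Ne.symm hne)
  obtain ⟨t, ht⟩ := WithTop.ne_top_iff_exists.1 (HahnSeries.orderTop_ne_top.2 hrem)
  obtain ⟨γ, hγ, rfl⟩ := hσ (Set.mem_univ t)
  have heq : ∀ t < σ γ, (D g).coeff t = f.coeff t := fun t hlt => by
    refine (sub_eq_zero.1 ?_).symm
    rw [← HahnSeries.coeff_sub]
    exact HahnSeries.coeff_eq_zero_of_lt_orderTop (ht ▸ WithTop.coe_lt_coe.2 hlt)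
  obtain ⟨a, ha⟩ := he γ hγ (-(D g).coeff (σ γ) + f.coeff (σ γ))
  have hsingle : ∀ s ∈ S, s < γ → (HahnSeries.single γ a).coeff s = 0 :=
    fun s _ hlt => HahnSeries.coeff_single_of_ne hlt.ne
  have hγ_exact := hg γ hγ ⟨g + HahnSeries.single γ a, fun t hle => by
    rw [map_add, HahnSeries.coeff_add]
    rcases hle.lt_or_eq with hlt | rfl
    · rw [hD.coeff_map_of_lt _ γ hγ hsingle t hlt, add_zero, heq t hlt]
    · rw [hD.coeff_map _ γ hγ hsingle, HahnSeries.coeff_single_same, ha, add_neg_cancel_left]⟩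
  refine HahnSeries.coeff_orderTop_ne ht.symm ?_
  rw [HahnSeries.coeff_sub, hγ_exact _ le_rfl, sub_self]

end IsTriangularOn

end Triangular

section LexOrder

variable {Γ R : Type*} [LinearOrder Γ]

lemma orderTop_sub_single_zero_pos [Zero Γ] [AddGroup R] {x : HahnSeries Γ R}
    (hx : 0 ≤ x.orderTop) :
    0 < (x - HahnSeries.single 0 (x.coeff 0)).orderTop := by
  refine ((le_min hx HahnSeries.orderTop_single_le).trans
    HahnSeries.min_orderTop_le_orderTop_sub).lt_of_ne' ?_
  exact HahnSeries.orderTop_ne_of_coeff_eq_zero (by simp)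

variable [LinearOrder R] [AddCommGroup R] [IsOrderedAddMonoid R]

lemma le_orderTop_of_mem_Icc {a b x : Lex (HahnSeries Γ R)} (hx : x ∈ Set.Icc a b)
    {i : WithTop Γ} (ha : i ≤ (ofLex a).orderTop) (hb : i ≤ (ofLex b).orderTop) :
    i ≤ (ofLex x).orderTop := by
  by_contra! hlt
  exact (abs_le_max_abs_abs hx.1 hx.2).not_gt <| max_lt
    (HahnSeries.abs_lt_abs_of_orderTop_ofLex (hlt.trans_le ha))
    (HahnSeries.abs_lt_abs_of_orderTop_ofLex (hlt.trans_le hb))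

variable [Zero Γ]

lemma abs_sub_single_zero_lt {x : Lex (HahnSeries Γ R)} (hx : 0 ≤ (ofLex x).orderTop) {d : R}
    (hd : 0 < d) :
    |x - toLex (HahnSeries.single 0 ((ofLex x).coeff 0))| < toLex (HahnSeries.single 0 d) := by
  have hpos : 0 < toLex (HahnSeries.single (0 : Γ) d) := by
    rw [← HahnSeries.leadingCoeff_pos_iff]
    exact hd.trans_eq HahnSeries.leadingCoeff_of_single.symm
  rw [← abs_of_pos hpos]
  refine HahnSeries.abs_lt_abs_of_orderTop_ofLex ?_
  exact (HahnSeries.orderTop_single hd.ne').trans_lt (orderTop_sub_single_zero_pos hx)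

lemma orderTop_neg_of_forall_single_zero_lt [Nontrivial R] {x : Lex (HahnSeries Γ R)}
    (hx : ∀ c : R, toLex (HahnSeries.single 0 c) < x) : (ofLex x).orderTop < 0 := by
  by_contra! h
  obtain ⟨d, hd⟩ := exists_zero_lt (α := R)
  have hlt := (abs_lt.1 (abs_sub_single_zero_lt h hd)).2
  rw [sub_lt_iff_lt_add, ← toLex_add, ← HahnSeries.single_add] at hlt
  exact (hx _).not_gt hlt

end LexOrder

section Exponents

variable {r s : Exponents.{u}} {α β : Ordinal.{u}}

lemma expo_ext (h : ∀ β, expo r β = expo s β) : r = s := Subtype.ext (funext h)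

lemma expo_sub (r s : Exponents.{u}) (β : Ordinal.{u}) :
    expo (r - s) β = expo r β - expo s β := rfl

lemma expo_ellDaggerExp (β γ : Ordinal.{u}) :
    expo (ellDaggerExp β) γ = if γ ≤ β then -1 else 0 :=
  if_congr Order.lt_succ_iff rfl rfl

lemma ne_zero_of_expo_ne_zero (h : expo r β ≠ 0) : r ≠ 0 := by
  rintro rfl
  exact h (expo_zero β)

lemma expo_lt_expo_of_lt (h : r < s) (heq : ∀ γ < β, expo r γ = expo s γ)
    (hne : expo r β ≠ expo s β) : expo r β < expo s β :=
  (Pi.apply_le_of_toLex (Subtype.coe_le_coe.2 h.le) heq).lt_of_ne hne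

/-- The least index at which an exponent sequence does not vanish; the junk value for the zero
sequence is `0`. -/
def leadIndex (r : Exponents.{u}) : Ordinal.{u} := sInf {β | expo r β ≠ 0}

lemma expo_leadIndex_ne_zero (hr : r ≠ 0) : expo r (leadIndex r) ≠ 0 := by
  refine csInf_mem (s := {β | expo r β ≠ 0}) ?_
  by_contra! h
  exact hr (expo_ext fun β => not_not.1 (Set.eq_empty_iff_forall_notMem.1 h β))

lemma expo_eq_zero_of_lt_leadIndex (h : β < leadIndex r) : expo r β = 0 :=
  not_not.1 (notMem_of_lt_csInf' h)

lemma leadIndex_le (h : expo r β ≠ 0) : leadIndex r ≤ β := csInf_le' h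

lemma leadIndex_eq (h : expo r β ≠ 0) (hlt : ∀ γ < β, expo r γ = 0) : leadIndex r = β :=
  (leadIndex_le h).eq_of_not_lt fun h' =>
    expo_leadIndex_ne_zero (ne_zero_of_expo_ne_zero h) (hlt _ h')

lemma expo_leadIndex_pos (hr : 0 < r) : 0 < expo r (leadIndex r) :=
  expo_lt_expo_of_lt hr (fun _ hγ => (expo_eq_zero_of_lt_leadIndex hγ).symm)
    (expo_leadIndex_ne_zero hr.ne').symm

/-- The exponent sequence of the dominant monomial of `∂ ℓ^r`, for `r ≠ 0`. -/
def derExp (r : Exponents.{u}) : Exponents.{u} := r + ellDaggerExp (leadIndex r)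

lemma expo_derExp_of_lt (h : β < leadIndex r) : expo (derExp r) β = -1 := by
  simp [derExp, expo_ellDaggerExp, h.le, expo_eq_zero_of_lt_leadIndex h]

lemma expo_derExp_leadIndex (r : Exponents.{u}) :
    expo (derExp r) (leadIndex r) = expo r (leadIndex r) - 1 := by
  simp [derExp, expo_ellDaggerExp, sub_eq_add_neg]

lemma expo_derExp_of_gt (h : leadIndex r < β) : expo (derExp r) β = expo r β := by
  simp [derExp, expo_ellDaggerExp, h.not_ge]

lemma derExp_strictMonoOn : StrictMonoOn derExp.{u} {0}ᶜ := by
  intro r hr s hs h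
  rcases lt_trichotomy (leadIndex r) (leadIndex s) with hlt | heq | hlt
  · have hs0 := expo_eq_zero_of_lt_leadIndex hlt
    have hneg : expo r (leadIndex r) < expo s (leadIndex r) :=
      expo_lt_expo_of_lt h (fun γ hγ => by
        rw [expo_eq_zero_of_lt_leadIndex hγ, expo_eq_zero_of_lt_leadIndex (hγ.trans hlt)])
        (hs0 ▸ expo_leadIndex_ne_zero hr)
    refine ⟨leadIndex r, fun γ hγ => ?_, ?_⟩
    · exact (expo_derExp_of_lt hγ).trans (expo_derExp_of_lt (hγ.trans hlt)).symm
    · change expo (derExp r) _ < expo (derExp s) _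
      rw [expo_derExp_leadIndex, expo_derExp_of_lt hlt]
      linarith
  · rw [derExp, derExp, heq]
    exact add_lt_add_left h _
  · have hr0 := expo_eq_zero_of_lt_leadIndex hlt
    have hpos : expo r (leadIndex s) < expo s (leadIndex s) :=
      expo_lt_expo_of_lt h (fun γ hγ => by
        rw [expo_eq_zero_of_lt_leadIndex hγ, expo_eq_zero_of_lt_leadIndex (hγ.trans hlt)])
        (hr0 ▸ (expo_leadIndex_ne_zero hs).symm)
    refine ⟨leadIndex s, fun γ hγ => ?_, ?_⟩
    · exact (expo_derExp_of_lt (hγ.trans hlt)).trans (expo_derExp_of_lt hγ).symm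
    · change expo (derExp r) _ < expo (derExp s) _
      rw [expo_derExp_leadIndex, expo_derExp_of_lt hlt]
      linarith

lemma derExp_surjOn : Set.SurjOn derExp.{u} {0}ᶜ Set.univ := by
  intro t _
  obtain ⟨α, hα⟩ := exists_mem_exponentsBelow t
  obtain ⟨β, hβ, hmin⟩ := Ordinal.lt_wf.has_min {β | expo t β ≠ -1} ⟨α, by simp [hα α le_rfl]⟩
  have hne : expo (t - ellDaggerExp β) β ≠ 0 := by
    rw [expo_sub, expo_ellDaggerExp, if_pos le_rfl]
    exact sub_ne_zero.2 hβ
  have hlead : leadIndex (t - ellDaggerExp β) = β := leadIndex_eq hne fun γ hγ => by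
    rw [expo_sub, expo_ellDaggerExp, if_pos hγ.le, sub_eq_zero]
    exact not_not.1 fun h => hmin γ h hγ
  refine ⟨t - ellDaggerExp β, ne_zero_of_expo_ne_zero hne, ?_⟩
  rw [derExp, hlead, sub_add_cancel]

lemma add_ellDaggerExp_le_derExp (h : expo r β ≠ 0) : r + ellDaggerExp β ≤ derExp r :=
  add_le_add_right (ellDaggerExp_antitone (leadIndex_le h)) r

lemma eq_of_add_ellDaggerExp_eq_derExp (hr : r ≠ 0) (hβ : expo s β ≠ 0) (hle : s ≤ r)
    (h : s + ellDaggerExp β = derExp r) : s = r :=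
  hle.eq_of_not_lt fun hlt => ((add_ellDaggerExp_le_derExp hβ).trans_lt
    (derExp_strictMonoOn (ne_zero_of_expo_ne_zero hβ) hr hlt)).ne h

lemma mem_exponentsBelow_succ_of_derExp_mem (h : derExp r ∈ exponentsBelow α) :
    r ∈ exponentsBelow (Order.succ α) := by
  have hlead : leadIndex r ≤ α := by
    by_contra! hlt
    have := (expo_derExp_of_lt hlt).symm.trans (h α le_rfl)
    norm_num at this
  intro γ hγ
  have hlt : α < γ := Order.succ_le_iff.1 hγ
  rw [← expo_derExp_of_gt (hlead.trans_lt hlt)]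
  exact h γ hlt.le

lemma add_ellDaggerExp_mem (h : derExp r ∈ exponentsBelow α) (hβ : expo r β ≠ 0) :
    r + ellDaggerExp β ∈ exponentsBelow α := by
  rcases (leadIndex_le hβ).eq_or_lt with rfl | hlt
  · exact h
  have hβα : β < α := by
    by_contra! hle
    exact hβ ((expo_derExp_of_gt hlt).symm.trans (h β hle))
  intro γ hγ
  have hβγ := hβα.trans_le hγ
  rw [expo_add, expo_ellDaggerExp, if_neg hβγ.not_ge, add_zero, ← expo_derExp_of_gt (hlt.trans hβγ)]
  exact h γ hγ

end Exponents

section Derivative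

variable {f : Series.{u}} {r t : Exponents.{u}} {α : Ordinal.{u}}

lemma coeff_derSeries (f : Series.{u}) (t : Exponents.{u}) :
    (derSeries f).coeff (toDual t) =
      ∑ᶠ β, expo (t - ellDaggerExp β) β * f.coeff (toDual (t - ellDaggerExp β)) :=
  (HahnSeries.SummableFamily.coeff_hsum (s := derFamily f)).trans
    (finsum_congr fun β => coeff_dagger_mul β (weight β f) (toDual t))

lemma exists_of_coeff_derSeries_ne_zero (h : (derSeries f).coeff (toDual t) ≠ 0) :
    ∃ s β, f.coeff (toDual s) ≠ 0 ∧ expo s β ≠ 0 ∧ s + ellDaggerExp β = t := by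
  rw [coeff_derSeries, ← finsum_mem_univ] at h
  obtain ⟨β, -, hβ⟩ := exists_ne_zero_of_finsum_mem_ne_zero h
  exact ⟨t - ellDaggerExp β, β, right_ne_zero_of_mul hβ, left_ne_zero_of_mul hβ,
    sub_add_cancel _ _⟩

lemma coeff_derSeries_derExp (h : ∀ s β, f.coeff (toDual s) ≠ 0 → expo s β ≠ 0 →
      s + ellDaggerExp β = derExp r → s = r) :
    (derSeries f).coeff (toDual (derExp r)) = expo r (leadIndex r) * f.coeff (toDual r) := by
  rw [coeff_derSeries, finsum_eq_single _ (leadIndex r), derExp, add_sub_cancel_right]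
  intro β hβ
  by_contra hne
  have hadd : derExp r - ellDaggerExp β + ellDaggerExp β = derExp r := sub_add_cancel _ _
  rw [h _ β (right_ne_zero_of_mul hne) (left_ne_zero_of_mul hne) hadd] at hadd
  exact hβ (ellDaggerExp_injective (add_left_cancel hadd))

lemma isTriangularOn_derSeries :
    IsTriangularOn derSeries.{u} (ofDual ⁻¹' {0}ᶜ) (toDual ∘ derExp ∘ ofDual)
      fun r c => expo (ofDual r) (leadIndex (ofDual r)) * c where
  monotoneOn := derExp_strictMonoOn.dual.monotoneOn
  injective _ hr := mul_right_injective₀ (expo_leadIndex_ne_zero hr)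
  coeff_map_of_lt f r hr hf t ht := by
    by_contra hne
    obtain ⟨s, β, hs, hβ, hst⟩ := exists_of_coeff_derSeries_ne_zero (t := ofDual t) hne
    have hs0 := ne_zero_of_expo_ne_zero hβ
    have hle : s ≤ ofDual r := not_lt.1 fun hlt => hs (hf (toDual s) hs0 hlt)
    refine (show derExp (ofDual r) < ofDual t from ht).not_ge ?_
    calc ofDual t = s + ellDaggerExp β := hst.symm
      _ ≤ derExp s := add_ellDaggerExp_le_derExp hβ
      _ ≤ derExp (ofDual r) := derExp_strictMonoOn.monotoneOn hs0 hr hle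
  coeff_map f r hr hf := coeff_derSeries_derExp fun s _ hs hβ =>
    eq_of_add_ellDaggerExp_eq_derExp hr hβ
      (not_lt.1 fun hlt => hs (hf (toDual s) (ne_zero_of_expo_ne_zero hβ) hlt))

lemma derExp_mem_of_isBelow_derSeries (hf : IsBelow α (derSeries f)) (hr0 : r ≠ 0)
    (hr : f.coeff (toDual r) ≠ 0) : derExp r ∈ exponentsBelow α := by
  by_contra hnot
  let bad : Set (Exponents.{u})ᵒᵈ :=
    {s | f.coeff s ≠ 0 ∧ ofDual s ≠ 0 ∧ derExp (ofDual s) ∉ exponentsBelow α}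
  have hwf : bad.IsWF := f.isWF_support.mono fun s hs => hs.1
  have hnonempty : bad.Nonempty := ⟨toDual r, hr, hr0, hnot⟩
  obtain ⟨hm, hm0, hmα⟩ := hwf.min_mem hnonempty
  set m := ofDual (hwf.min hnonempty)
  refine hmα (hf (toDual (derExp m)) ?_)
  rw [HahnSeries.mem_support, coeff_derSeries_derExp]
  · exact mul_ne_zero (expo_leadIndex_ne_zero hm0) hm
  · intro s β hs hβ hadd
    have hsα : derExp s ∉ exponentsBelow α := fun h => hmα (hadd ▸ add_ellDaggerExp_mem h hβ)
    exact eq_of_add_ellDaggerExp_eq_derExp hm0 hβ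
      (hwf.min_le hnonempty (a := toDual s) ⟨hs, ne_zero_of_expo_ne_zero hβ, hsα⟩) hadd

lemma isBelow_succ_of_isBelow_derSeries (hf : IsBelow α (derSeries f)) :
    IsBelow (Order.succ α) f := by
  intro r hr
  by_cases hr0 : ofDual r = 0
  · rw [hr0]
    exact zero_mem _
  · exact mem_exponentsBelow_succ_of_derExp_mem (derExp_mem_of_isBelow_derSeries hf hr0 hr)

end Derivative

section Field

-- Without this shortcut, instance search for `Algebra ℝ LL` runs into the heartbeat limit.
local instance : Algebra ℝ LL.{u} := LL.algebra'

variable {f g : LL.{u}}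

lemma coeff_eq_of_der_eq (h : der f = der g) {r : Exponents.{u}} (hr : r ≠ 0) :
    f.1.coeff (toDual r) = g.1.coeff (toDual r) :=
  isTriangularOn_derSeries.coeff_eq_of_map_eq (γ := toDual r) (congrArg Subtype.val h) hr

lemma der_eq_zero_iff : der f = 0 ↔ f ∈ Set.range (algebraMap ℝ LL.{u}) := by
  refine ⟨fun h => ⟨f.1.coeff 0, Subtype.ext (HahnSeries.ext (funext fun r => ?_))⟩, ?_⟩
  · by_cases hr : r = 0
    · rw [hr]
      exact HahnSeries.coeff_single_same _ _
    · refine (HahnSeries.coeff_single_of_ne hr).trans ?_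
      exact (coeff_eq_of_der_eq (h.trans der.map_zero.symm) hr).symm
  · rintro ⟨c, rfl⟩
    exact der.map_algebraMap c

lemma eq_of_der_eq (h : der f = der g) (hf : 0 ∉ supp f) (hg : 0 ∉ supp g) : f = g := by
  refine Subtype.ext (HahnSeries.ext (funext fun r => ?_))
  by_cases hr : ofDual r = 0
  · rw [← toDual_ofDual r, hr]
    exact (not_not.1 hf).trans (not_not.1 hg).symm
  · exact coeff_eq_of_der_eq h hr

lemma exists_der_eq (f : LL.{u}) : ∃ g, der g = f ∧ 0 ∉ supp g := by
  obtain ⟨α, hα⟩ := f.2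
  obtain ⟨g, hg, hgf⟩ := isTriangularOn_derSeries.exists_map_eq
    (fun t _ => derExp_surjOn (Set.mem_univ (ofDual t)))
    (fun r hr => mul_left_surjective₀ (expo_leadIndex_ne_zero hr)) f.1
  have hbelow : IsBelow (Order.succ α) g := isBelow_succ_of_isBelow_derSeries (hgf ▸ hα)
  exact ⟨⟨g, _, hbelow⟩, Subtype.ext hgf, fun h => hg h rfl⟩

lemma der_pos_of_orderTop_neg (hf : 0 < f) (hneg : f.1.orderTop < 0) : 0 < der f := by
  have hne : f.1 ≠ 0 := fun h => hf.ne' (Subtype.ext h)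
  have horder : f.1.order < 0 := by
    rwa [← HahnSeries.order_eq_orderTop_of_ne_zero hne, WithTop.coe_lt_zero] at hneg
  have hlt : ∀ s ∈ ofDual ⁻¹' {0}ᶜ, s < f.1.order → f.1.coeff s = 0 := fun s _ hs =>
    HahnSeries.coeff_eq_zero_of_lt_order hs
  have hlead : 0 < f.1.coeff f.1.order := by
    rw [← HahnSeries.leadingCoeff_eq]
    exact HahnSeries.leadingCoeff_pos_iff.2 hf
  refine (HahnSeries.lt_iff _ _).2 ⟨toDual (derExp (ofDual f.1.order)), fun t ht => ?_, ?_⟩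
  · exact (isTriangularOn_derSeries.coeff_map_of_lt f.1 _ horder.ne hlt t ht).symm
  · exact (mul_pos (expo_leadIndex_pos horder) hlead).trans_eq
      (isTriangularOn_derSeries.coeff_map f.1 _ horder.ne hlt).symm

lemma isHField_der : IsHField der.{u} where
  der_pos f hf := by
    have hconst (c : ℝ) : algebraMap ℝ LL.{u} c < f := hf _ (der.map_algebraMap c)
    have hpos : 0 < f := (map_zero (algebraMap ℝ LL.{u})).symm.trans_lt (hconst 0)
    exact der_pos_of_orderTop_neg hpos
      (orderTop_neg_of_forall_single_zero_lt (x := toLex f.1) hconst)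
  exists_const_add f := by
    rintro ⟨a, b, ha, hb, haf, hfb⟩
    obtain ⟨a, rfl⟩ := der_eq_zero_iff.1 ha
    obtain ⟨b, rfl⟩ := der_eq_zero_iff.1 hb
    have hf : 0 ≤ f.1.orderTop := le_orderTop_of_mem_Icc (x := toLex f.1) ⟨haf, hfb⟩
      HahnSeries.orderTop_single_le HahnSeries.orderTop_single_le
    refine ⟨algebraMap ℝ LL.{u} (f.1.coeff 0), f - algebraMap ℝ LL.{u} (f.1.coeff 0),
      der.map_algebraMap _, fun d hd hdpos => ?_, (add_sub_cancel _ _).symm⟩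
    obtain ⟨d, rfl⟩ := der_eq_zero_iff.1 hd
    have hd0 : 0 < d := by
      have := HahnSeries.leadingCoeff_pos_iff.2 hdpos
      exact this.trans_eq HahnSeries.leadingCoeff_of_single
    obtain ⟨hlower, hupper⟩ := abs_lt.1 (abs_sub_single_zero_lt (x := toLex f.1) hf hd0)
    exact abs_lt.2 ⟨hlower, hupper⟩

end Field

end LogHyper

end

theorem mainTheorem2 :
    {f : LogHyper.LL.{u} | LogHyper.der f = 0} = Set.range (algebraMap ℝ LogHyper.LL.{u}) ∧
    LogHyper.IsHField LogHyper.der.{u} ∧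
    Function.Surjective LogHyper.der.{u} ∧
    ∃ integ : LogHyper.LL.{u} → LogHyper.LL.{u}, ∀ f g : LogHyper.LL.{u},
      g = integ f ↔ LogHyper.der g = f ∧ (0 : LogHyper.Exponents.{u}) ∉ LogHyper.supp g := by
  refine ⟨Set.ext fun f => LogHyper.der_eq_zero_iff, LogHyper.isHField_der,
    fun f => (LogHyper.exists_der_eq f).imp fun _ h => h.1, ?_⟩
  choose integ der_integ zero_notMem_supp using LogHyper.exists_der_eq.{u}
  refine ⟨integ, fun f g => ⟨?_, fun ⟨hder, hsupp⟩ => ?_⟩⟩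
  · rintro rfl
    exact ⟨der_integ f, zero_notMem_supp f⟩
  · exact LogHyper.eq_of_der_eq (hder.trans (der_integ f).symm) hsupp (zero_notMem_supp f)
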